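/- Let $L=\{L_t\}_{t\in\mathbb R}$ be a centred process with stationary orthogonal increments and variance parameter $\sigma^2<\infty$, i.e. its increments are square integrable with mean $0$, increments over non-overlapping intervals are orthogonal, and $\mathbb E[(L_t-L_s)^2]=\sigma^2|t-s|$ for all $s,t$ (for example, a two-sided Lévy process with $\mathbb E L_t=0$ and $\operatorname{Var}L_t=\sigma^2|t|$). Let $g\in L^2(\mathbb R)$ be real-valued and zero on $(-\infty,0]$, and let $$Y_t=\int_{-\infty}^{\infty}g(t-s)\,dL_s,\qquad t\in\mathbb R,$$ the integral being understood in the $L^2$-sense. Suppose that $Y$ has a spectral density $f_Y$, i.e. a nonnegative integrable function with $\operatorname{Cov}(Y_{t+h},Y_t)=\int_{-\infty}^\infty e^{ih\omega}f_Y(\omega)\,d\omega$ for all $t,h\in\mathbb R$, of the form $$f_Y(\omega)=|\omega|^{-\alpha}\,\ell(|\omega|),\qquad \omega\neq 0,$$ where $\ell:(0,\infty)\to(0,\infty)$ is measurable and slowly varying at infinity, i.e. $\lim_{x\to\infty}\ell(cx)/\ell(x)=1$ for every $c>0$. Let $p$ be a real number (for example a positive integer) such that $1<\alpha<2p+1$.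 For $\Delta>0$ let $Y^\Delta_n=Y_{n\Delta}$, $n\in\mathbb Z$, let $B$ be the backward shift, $BY^\Delta_n=Y^\Delta_{n-1}$, and let $$(1-B)^pY^\Delta_n=\sum_{j=0}^\infty(-1)^j\binom pj Y^\Delta_{n-j}.$$ This series (a finite sum if $p$ is an integer) converges in mean square and its sum has a finite second moment. For every $n\in\mathbb Z$, as $\Delta\downarrow 0$, $$\mathbb E\big[((1-B)^pY^\Delta_n)^2\big]\sim 2^p\,S_{p,\alpha}\,\ell(\Delta^{-1})\,\Delta^{\alpha-1},$$ i.e. the quotient of the two sides tends to $1$, where $$S_{p,\alpha}=\int_{-\pi}^{\pi}(1-\cos\omega)^p\Big[|\omega|^{-\alpha}+(2\pi)^{-\alpha}\zeta\Big(\alpha,1-\frac{\omega}{2\pi}\Big)+(2\pi)^{-\alpha}\zeta\Big(\alpha,1+\frac{\omega}{2\pi}\Big)\Big]d\omega$$ and $\zeta(s,r)=\sum_{k=0}^\infty (r+k)^{-s}$ is the Hurwitz zeta function. -/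

import Mathlib

open MeasureTheory ProbabilityTheory Filter Topology

noncomputable section

/-! ### The driving process -/

/-- `L = (L_t)_{t ∈ ℝ}` is a process with stationary orthogonal increments, centred, with
variance parameter `σ²`: the increments are square integrable with mean zero, increments over
non-overlapping intervals are orthogonal, and `E (L_t - L_s)² = σ² |t - s|`. -/
structure HasStationaryOrthogonalIncrements {Ω : Type*} [MeasurableSpace Ω]
    (L : ℝ → Ω → ℝ) (σ : ℝ) (P : Measure Ω) : Prop where
  memLp : ∀ s t : ℝ, MemLp (fun w => L t w - L s w) 2 P
  mean_zero : ∀ s t : ℝ, ∫ w, (L t w - L s w) ∂P = 0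
  orthogonal : ∀ a b c d : ℝ, a ≤ b → b ≤ c → c ≤ d →
    ∫ w, (L b w - L a w) * (L d w - L c w) ∂P = 0
  second_moment : ∀ s t : ℝ, ∫ w, (L t w - L s w) ^ 2 ∂P = σ ^ 2 * |t - s|

/-- `L = (L_t)_{t ∈ ℝ}` is a two-sided Lévy process with `E L_t = 0` and
`Var L_t = σ² |t| < ∞`. -/
structure IsCentredLevyProcess {Ω : Type*} [MeasurableSpace Ω]
    (L : ℝ → Ω → ℝ) (σ : ℝ) (P : Measure Ω) : Prop where
  zero : ∀ᵐ w ∂P, L 0 w = 0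
  indep : HasIndepIncrements L P
  stationary : ∀ s t : ℝ, s ≤ t → IdentDistrib (fun w => L t w - L s w) (L (t - s)) P P
  continuous : ∀ s : ℝ, TendstoInMeasure P L (𝓝 s) (L s)
  memLp : ∀ t : ℝ, MemLp (L t) 2 P
  mean_zero : ∀ t : ℝ, ∫ w, L t w ∂P = 0
  second_moment : ∀ t : ℝ, ∫ w, (L t w) ^ 2 ∂P = σ ^ 2 * |t|

/-- Centred square integrable Lévy processes have stationary orthogonal increments. -/
theorem IsCentredLevyProcess.hasStationaryOrthogonalIncrements {Ω : Type*} [MeasurableSpace Ω]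
    {L : ℝ → Ω → ℝ} {σ : ℝ} {P : Measure Ω} [IsProbabilityMeasure P]
    (h : IsCentredLevyProcess L σ P) : HasStationaryOrthogonalIncrements L σ P := by
  have hm : ∀ s t : ℝ, ∫ w, (L t w - L s w) ∂P = 0 := fun s t => by
    rw [integral_sub ((h.memLp t).integrable (by norm_num))
      ((h.memLp s).integrable (by norm_num)), h.mean_zero, h.mean_zero, sub_zero]
  have hs : ∀ s t : ℝ, s ≤ t → ∫ w, (L t w - L s w) ^ 2 ∂P = σ ^ 2 * |t - s| := fun s t hst => by
    have h1 := ((h.stationary s t hst).comp (u := fun x : ℝ => x ^ 2) (by fun_prop)).integral_eq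
    simp only [Function.comp_def] at h1
    rw [h1, h.second_moment]
  refine ⟨fun s t => (h.memLp t).sub (h.memLp s), hm, fun a b c d hab hbc hcd => ?_,
    fun s t => ?_⟩
  · have hi : IndepFun (fun w => L b w - L a w) (fun w => L d w - L c w) P := by
      let τ : ℕ → ℝ := fun k => if k = 0 then a else if k = 1 then b else if k = 2 then c else d
      have hτ : Monotone τ := monotone_nat_of_le_succ fun k => by
        rcases k with _ | _ | _ | k <;> simp [τ, hab, hbc, hcd]
      have h2 := (h.indep.nat hτ).indepFun (i := 0) (j := 2) (by norm_num)
      simpa [τ] using h2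
    have h3 := hi.integral_mul_eq_mul_integral
      ((h.memLp b).sub (h.memLp a)).1 ((h.memLp d).sub (h.memLp c)).1
    simp only [Pi.mul_apply] at h3
    rw [h3, hm, zero_mul]
  · rcases le_total s t with hst | hst
    · exact hs s t hst
    · rw [abs_sub_comm, ← hs t s hst]
      congr 1
      ext w
      ring

/-! ### The `L²` integral and continuous-time moving averages -/

/-- A step function on `ℝ`: it equals `coef i` on `(knot i, knot (i + 1)]` for `i < size`, and
vanishes elsewhere. -/
structure StepFunction where
  size : ℕ
  knot : ℕ → ℝ
  coef : ℕ → ℝ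
  mono : Monotone knot

/-- The function on `ℝ` given by a step function. -/
def StepFunction.toFun (φ : StepFunction) (s : ℝ) : ℝ :=
  ∑ i ∈ Finset.range φ.size,
    (Set.Ioc (φ.knot i) (φ.knot (i + 1))).indicator (fun _ => φ.coef i) s

/-- The elementary integral `∫ φ dL` of a step function. -/
def StepFunction.integral {Ω : Type*} (φ : StepFunction) (L : ℝ → Ω → ℝ) (w : Ω) : ℝ :=
  ∑ i ∈ Finset.range φ.size, φ.coef i * (L (φ.knot (i + 1)) w - L (φ.knot i) w)

/-- `X = ∫ h(s) dL_s` in the `L²` sense: `X` is the mean-square limit of the elementary integrals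
of step functions converging to `h` in `L²(ℝ)`. -/
def IsL2Integral {Ω : Type*} [MeasurableSpace Ω] (L : ℝ → Ω → ℝ) (P : Measure Ω)
    (h : ℝ → ℝ) (X : Ω → ℝ) : Prop :=
  MemLp X 2 P ∧ ∃ φ : ℕ → StepFunction,
    Tendsto (fun m => eLpNorm (fun s => (φ m).toFun s - h s) 2 volume) atTop (𝓝 0) ∧
    Tendsto (fun m => eLpNorm (fun w => (φ m).integral L w - X w) 2 P) atTop (𝓝 0)

/-- `Y_t = ∫ g(t - s) dL_s` for all `t ∈ ℝ`, with a causal square integrable kernel `g`. -/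
structure IsCMAProcess {Ω : Type*} [MeasurableSpace Ω] (Y : ℝ → Ω → ℝ) (g : ℝ → ℝ)
    (L : ℝ → Ω → ℝ) (P : Measure Ω) : Prop where
  kernel_memLp : MemLp g 2 volume
  causal : ∀ t ≤ 0, g t = 0
  eq_integral : ∀ t : ℝ, IsL2Integral L P (fun s => g (t - s)) (Y t)

/-- `f` is the spectral density of the (weakly stationary) process `Y`: it is nonnegative and
integrable, and `Cov(Y_{t+h}, Y_t) = ∫ e^{ihω} f(ω) dω` for all `t, h`. -/
structure IsSpectralDensity {Ω : Type*} [MeasurableSpace Ω] (Y : ℝ → Ω → ℝ) (f : ℝ → ℝ)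
    (P : Measure Ω) : Prop where
  nonneg : 0 ≤ᵐ[volume] f
  integrable : Integrable f volume
  covariance_eq : ∀ t h : ℝ, ((cov[Y (t + h), Y t; P] : ℝ) : ℂ) =
    ∫ ω : ℝ, Complex.exp (Complex.I * (h : ℂ) * (ω : ℂ)) * (f ω : ℂ)

/-! ### Regular variation, the Hurwitz zeta function, differencing -/

/-- `f`, considered on `(0, ∞)`, is positive, measurable and regularly varying of index `ρ` at
infinity. -/
structure IsRegularlyVarying (ρ : ℝ) (f : ℝ → ℝ) : Prop where
  pos : ∀ x : ℝ, 0 < x → 0 < f x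
  measurable : Measurable fun x : Set.Ioi (0 : ℝ) => f x
  tendsto : ∀ c : ℝ, 0 < c → Tendsto (fun x => f (c * x) / f x) atTop (𝓝 (c ^ ρ))

/-- The Hurwitz zeta function `ζ(s, r) = ∑_{k ≥ 0} (r + k)^{-s}` for real `s > 1` and `r > 0`.
(Mathlib's `hurwitzZeta` is made periodic in `r`, so it is a different function for `r > 1`.) -/
def realHurwitzZeta (s r : ℝ) : ℝ := ∑' k : ℕ, 1 / (r + k) ^ s

/-- `|ω|^{-α} + (2π)^{-α} ζ(α, 1 - ω/2π) + (2π)^{-α} ζ(α, 1 + ω/2π)`. -/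
def hurwitzBracket (α ω : ℝ) : ℝ :=
  |ω| ^ (-α) + (2 * Real.pi) ^ (-α) * realHurwitzZeta α (1 - ω / (2 * Real.pi))
    + (2 * Real.pi) ^ (-α) * realHurwitzZeta α (1 + ω / (2 * Real.pi))

/-- The constant `S_{p,α}`. -/
def incrementConst (p α : ℝ) : ℝ :=
  ∫ ω in (-Real.pi)..Real.pi, (1 - Real.cos ω) ^ p * hurwitzBracket α ω

/-- The sampled sequence `Y^Δ_n = Y_{nΔ}`, `n ∈ ℤ`. -/
def sampled {Ω : Type*} (Y : ℝ → Ω → ℝ) (Δ : ℝ) (n : ℤ) : Ω → ℝ := Y (n * Δ)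

/-- The partial sum `∑_{j < N} (-1)^j (p choose j) X_{n-j}` of the binomial expansion of
`(1 - B)^p X_n`, where `B X_n = X_{n-1}`. -/
def fracDiffPartial {Ω : Type*} (p : ℝ) (X : ℤ → Ω → ℝ) (N : ℕ) (n : ℤ) (w : Ω) : ℝ :=
  ∑ j ∈ Finset.range N, (-1) ^ j * Ring.choose p j * X (n - j) w

/-- `(1 - B)^p X_n = ∑_{j ≥ 0} (-1)^j (p choose j) X_{n-j}` for real `p`; the sum is finite when
`p` is a natural number. -/
def fracDiff {Ω : Type*} (p : ℝ) (X : ℤ → Ω → ℝ) (n : ℤ) (w : Ω) : ℝ :=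
  ∑' j : ℕ, (-1) ^ j * Ring.choose p j * X (n - j) w

/-- For natural `p`, `(1 - B)^p` is the usual finite difference operator. -/
theorem fracDiff_natCast {Ω : Type*} (p : ℕ) (X : ℤ → Ω → ℝ) (n : ℤ) (w : Ω) :
    fracDiff p X n w = ∑ j ∈ Finset.range (p + 1), (-1) ^ j * (p.choose j : ℝ) * X (n - j) w := by
  unfold fracDiff
  simp only [Ring.choose_natCast]
  refine tsum_eq_sum fun j hj => ?_
  rw [Nat.choose_eq_zero_of_lt (by simpa using hj)]
  simp

end

/-! ### The binomial series on the closed unit disc -/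

/-! On the spectral side, `(1 - B)^p` multiplies by `(1 - e^{iΔω})^p`, and `|1 - e^{iΔω}|² = 2 (1 -
cos Δω)`. The second moment is therefore `2^p ∫ (1 - cos Δω)^p f(ω) dω` (`integral_fracDiff_sq`).
The moving average enters through square integrability and zero mean of `Y`.

With `u = Δω` the integral becomes `Δ^{α-1} ∫ (1 - cos u)^p |u|^{-α} ℓ(|u|/Δ) du`. After division by
`ℓ(1/Δ)` the integrand tends to `diffKernel p α u`, and Potter's bound, proved here through the
uniform convergence theorem, gives a dominating function. The bound holds only beyond some frequency
`X`. Below `X` the integrability of `f` and `(1 - cos Δω)^p ≤ (XΔ)^{2p}` suffice, because `2p > α -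
1`.

Finally, `∫ diffKernel` over the line is folded onto one period of the cosine; the translates of
`|u|^{-α}` sum to the Hurwitz zeta terms of `incrementConst` (`integral_diffKernel_eq`). -/

theorem succ_mul_choose_succ (p : ℝ) (j : ℕ) :
    ((j : ℝ) + 1) * Ring.choose p (j + 1) = Ring.choose p j * (p - j) := by
  have h := Ring.choose_smul_choose p (Nat.le_succ j)
  simp only [Nat.succ_eq_add_one, Nat.choose_succ_self_right, nsmul_eq_mul, add_tsub_cancel_left,
    Ring.choose_one_right, Nat.cast_add, Nat.cast_one] at h
  exact h

/-- For `j ≥ p` the factor `p - j` in the recurrence has constant sign, so `p |c_j| = j |c_j| -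
(j+1) |c_{j+1}|` with `c_j = Ring.choose p j`. The tail telescopes and is bounded by its first
boundary term. -/
theorem summable_abs_choose {p : ℝ} (hp : 0 < p) : Summable fun j : ℕ => |Ring.choose p j| := by
  obtain ⟨m, hm⟩ := exists_nat_ge p
  rw [← summable_nat_add_iff m]
  have key : ∀ j : ℕ, p * |Ring.choose p (j + m)| =
      ((j + m : ℕ) : ℝ) * |Ring.choose p (j + m)|
        - ((j + 1 + m : ℕ) : ℝ) * |Ring.choose p (j + 1 + m)| := fun j => by
    have h := congrArg abs (succ_mul_choose_succ p (j + m))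
    have hj : p ≤ ((j + m : ℕ) : ℝ) := by push_cast; linarith [Nat.cast_nonneg (α := ℝ) j]
    rw [abs_mul, abs_mul, abs_of_nonpos (sub_nonpos.2 hj), abs_of_nonneg (by positivity)] at h
    rw [show j + 1 + m = j + m + 1 by ring, Nat.cast_succ, h]
    ring
  have hsum : ∀ N : ℕ, p * ∑ j ∈ Finset.range N, |Ring.choose p (j + m)| =
      (m : ℝ) * |Ring.choose p m| - ((N + m : ℕ) : ℝ) * |Ring.choose p (N + m)| := fun N => by
    rw [Finset.mul_sum, Finset.sum_congr rfl fun j _ => key j, Finset.sum_range_sub'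
      (fun j => ((j + m : ℕ) : ℝ) * |Ring.choose p (j + m)|)]
    simp
  refine summable_of_sum_range_le (c := (m : ℝ) * |Ring.choose p m| / p)
    (fun _ => abs_nonneg _) fun N => ?_
  rw [le_div_iff₀' hp, hsum]
  have : 0 ≤ ((N + m : ℕ) : ℝ) * |Ring.choose p (N + m)| := by positivity
  linarith

theorem summable_abs_diffCoeff {p : ℝ} (hp : 0 < p) :
    Summable fun j : ℕ => |(-1) ^ j * Ring.choose p j| := by
  simpa [abs_mul] using summable_abs_choose hp

theorem hasSum_one_sub_cpow (p : ℝ) {z : ℂ} (hz : ‖z‖ < 1) :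
    HasSum (fun j : ℕ => (((-1) ^ j * Ring.choose p j : ℝ) : ℂ) * z ^ j) ((1 - z) ^ (p : ℂ)) := by
  have h := (Complex.one_add_cpow_hasFPowerSeriesOnBall_zero (a := (p : ℂ))).hasSum
    (y := -z) (by
      rw [Metric.mem_eball, edist_zero_right, enorm_neg, ← ofReal_norm, ENNReal.ofReal_lt_one]
      exact hz)
  simp only [binomialSeries_apply, List.ofFn_const, List.prod_replicate,
    smul_eq_mul] at h
  rw [zero_add, ← sub_eq_add_neg] at h
  refine h.congr_fun fun j => ?_
  rw [neg_pow z, ← Complex.ofReal_choose]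
  push_cast
  ring

/-- The identity is needed on the unit circle, where the binomial theorem does not reach. Both sides
are continuous on the closed disc, so it extends from the open one. Taking norms leaves a real power
of `‖1 - z‖`, whose continuity at `z = 1` is immediate. -/
theorem norm_tsum_diffCoeff {p : ℝ} (hp : 0 < p) {z : ℂ} (hz : ‖z‖ ≤ 1) :
    ‖∑' j : ℕ, (((-1) ^ j * Ring.choose p j : ℝ) : ℂ) * z ^ j‖ = ‖1 - z‖ ^ p := by
  have hcont : ContinuousOn (fun z : ℂ => ∑' j : ℕ, (((-1) ^ j * Ring.choose p j : ℝ) : ℂ) * z ^ j)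
      (Metric.closedBall 0 1) := by
    refine continuousOn_tsum (fun j => by fun_prop) (summable_abs_diffCoeff hp) fun j z hz => ?_
    rw [norm_mul, norm_pow, Complex.norm_real, Real.norm_eq_abs]
    exact mul_le_of_le_one_right (abs_nonneg _)
      (pow_le_one₀ (norm_nonneg _) (by simpa using hz))
  have hEq : Set.EqOn
      (fun z : ℂ => ‖∑' j : ℕ, (((-1) ^ j * Ring.choose p j : ℝ) : ℂ) * z ^ j‖)
      (fun z => ‖1 - z‖ ^ p) (Metric.ball 0 1) := fun z hz => by
    simp only
    rw [(hasSum_one_sub_cpow p (by simpa using hz)).tsum_eq, Complex.norm_cpow_real]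
  refine hEq.of_subset_closure hcont.norm ?_ Metric.ball_subset_closedBall
    (closure_ball (0 : ℂ) one_ne_zero).ge (by simpa using hz)
  exact ((continuous_const.sub continuous_id).norm.rpow_const
    fun _ => Or.inr hp.le).continuousOn

theorem norm_one_sub_exp_rpow (p x : ℝ) :
    (‖1 - Complex.exp (Complex.I * x)‖ ^ p) ^ 2 = 2 ^ p * (1 - Real.cos x) ^ p := by
  have h : ‖1 - Complex.exp (Complex.I * x)‖ ^ 2 = 2 * (1 - Real.cos x) := by
    rw [← Complex.normSq_eq_norm_sq, mul_comm, Complex.exp_mul_I, Complex.normSq_apply]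
    simp only [Complex.sub_re, Complex.sub_im, Complex.add_re, Complex.add_im, Complex.one_re,
      Complex.one_im, Complex.mul_re, Complex.mul_im, Complex.I_re, Complex.I_im,
      Complex.cos_ofReal_re, Complex.cos_ofReal_im, Complex.sin_ofReal_re, Complex.sin_ofReal_im]
    nlinarith [Real.sin_sq_add_cos_sq x]
  rw [← Real.rpow_natCast, ← Real.rpow_mul (norm_nonneg _), mul_comm p, Real.rpow_mul (norm_nonneg _),
    Real.rpow_natCast, h, Real.mul_rpow (by norm_num) (by linarith [Real.cos_le_one x])]

/-! ### Mean square convergence of series -/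

section MeanSquare

variable {Ω : Type*} [MeasurableSpace Ω] {P : Measure Ω}

/-- Completeness gives a sum in `Lp`. Almost everywhere the pointwise series converges to it, so the
pointwise `tsum` is not the default value `0` there. -/
theorem memLp_tsum_and_tendsto {y : ℕ → Ω → ℝ} (hy : ∀ j, MemLp (y j) 2 P)
    (hsum : ∑' j, eLpNorm (y j) 2 P ≠ ⊤) :
    MemLp (fun w => ∑' j, y j w) 2 P ∧
      Tendsto (fun N : ℕ => eLpNorm (fun w => ∑ j ∈ Finset.range N, y j w - ∑' j, y j w) 2 P)
        atTop (𝓝 0) := by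
  set F : ℕ → Lp ℝ 2 P := fun j => (hy j).toLp (y j) with hF
  have hFsum : ∑' j, ‖F j‖ₑ ≠ ⊤ := by simpa [hF, Lp.enorm_toLp] using hsum
  have hae : ∀ᵐ w ∂P, ∀ j, F j w = y j w := ae_all_iff.2 fun j => (hy j).coeFn_toLp
  have hT : (∑' j, F j : Lp ℝ 2 P) =ᵐ[P] fun w => ∑' j, y j w := by
    filter_upwards [hae, Lp.hasSum_coeFn_tsum hFsum] with w hw hs
    rw [← hs.tsum_eq]
    exact tsum_congr hw
  have hmem : MemLp (fun w => ∑' j, y j w) 2 P := (memLp_congr_ae hT).1 (Lp.memLp _)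
  refine ⟨hmem, ?_⟩
  have hS : ∀ N : ℕ, MemLp (fun w => ∑ j ∈ Finset.range N, y j w) 2 P :=
    fun N => memLp_finsetSum _ fun j _ => hy j
  refine (Lp.tendsto_Lp_iff_tendsto_eLpNorm'' _ hS _ hmem).1 ?_
  have h1 : ∀ N, (hS N).toLp _ = ∑ j ∈ Finset.range N, F j := fun N => by
    refine Lp.ext ?_
    filter_upwards [(hS N).coeFn_toLp, hae, Lp.coeFn_fun_finsetSum (Finset.range N) F]
      with w h1 h2 h3
    rw [h1, h3]
    exact Finset.sum_congr rfl fun j _ => (h2 j).symm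
  have h2 : hmem.toLp _ = ∑' j, F j := Lp.ext (hmem.coeFn_toLp.trans hT.symm)
  simp only [h1, h2]
  exact (Summable.of_enorm hFsum).tendsto_sum_tsum_nat

theorem tendsto_integral_sq {X : ℕ → Ω → ℝ} {Z : Ω → ℝ} (hX : ∀ N, MemLp (X N) 2 P)
    (hZ : MemLp Z 2 P) (h : Tendsto (fun N => eLpNorm (fun w => X N w - Z w) 2 P) atTop (𝓝 0)) :
    Tendsto (fun N => ∫ w, X N w ^ 2 ∂P) atTop (𝓝 (∫ w, Z w ^ 2 ∂P)) := by
  have hnorm : ∀ {W : Ω → ℝ} (hW : MemLp W 2 P), ‖hW.toLp W‖ ^ 2 = ∫ w, W w ^ 2 ∂P := by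
    intro W hW
    rw [← real_inner_self_eq_norm_sq, L2.inner_def]
    refine integral_congr_ae ?_
    filter_upwards [hW.coeFn_toLp] with w hw
    rw [hw, real_inner_self_eq_norm_sq, Real.norm_eq_abs, sq_abs]
  have h1 := ((Lp.tendsto_Lp_iff_tendsto_eLpNorm'' X hX Z hZ).2 h).norm.pow 2
  simpa only [hnorm] using h1

theorem tsum_eLpNorm_const_mul_ne_top {c : ℕ → ℝ} {y : ℕ → Ω → ℝ} {C : ENNReal} (hC : C ≠ ⊤)
    (hc : Summable fun j => |c j|) (hy : ∀ j, eLpNorm (y j) 2 P ≤ C) :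
    ∑' j, eLpNorm (fun w => c j * y j w) 2 P ≠ ⊤ := by
  have h1 : ∑' j, ‖c j‖ₑ ≠ ⊤ := tsum_enorm_ne_top_iff_summable_norm.2 hc
  refine ne_top_of_le_ne_top (ENNReal.mul_ne_top h1 hC) ?_
  rw [← ENNReal.tsum_mul_right]
  refine ENNReal.tsum_le_tsum fun j => ?_
  exact (eLpNorm_const_smul_le (c := c j) (f := y j)).trans (mul_le_mul_right (hy j) _)

/-! ### Second moments of moving averages -/

/-- Elementary integrals are centred, and mean-square convergence on a probability space implies
convergence of means. -/
theorem IsL2Integral.integral_eq_zero [IsProbabilityMeasure P] {L : ℝ → Ω → ℝ} {σ : ℝ}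
    {h : ℝ → ℝ} {X : Ω → ℝ} (hL : HasStationaryOrthogonalIncrements L σ P)
    (hX : IsL2Integral L P h X) : ∫ w, X w ∂P = 0 := by
  obtain ⟨hX2, φ, -, hφ⟩ := hX
  have hmem : ∀ m, MemLp ((φ m).integral L) 2 P := fun m =>
    memLp_finsetSum _ fun i _ => (hL.memLp _ _).const_mul _
  have hzero : ∀ m, ∫ w, (φ m).integral L w ∂P = 0 := fun m => by
    unfold StepFunction.integral
    rw [integral_finsetSum _ fun i _ =>
      ((hL.memLp _ _).const_mul _).integrable (by norm_num)]
    simp [integral_const_mul, hL.mean_zero]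
  have h1 : Tendsto (fun m => eLpNorm ((φ m).integral L - X) 1 P) atTop (𝓝 0) :=
    tendsto_of_tendsto_of_tendsto_of_le_of_le tendsto_const_nhds hφ (fun _ => zero_le)
      fun m => eLpNorm_le_eLpNorm_of_exponent_le (by norm_num) ((hmem m).sub hX2).1
  have h2 := tendsto_integral_of_L1' X hX2.1
    (Eventually.of_forall fun m => (hmem m).integrable (by norm_num)) h1
  simp only [hzero] at h2
  exact (tendsto_nhds_unique h2 tendsto_const_nhds)

theorem integrable_exp_mul {f : ℝ → ℝ} (hf : Integrable f) (h : ℝ) :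
    Integrable fun ω : ℝ => Complex.exp (Complex.I * (h : ℂ) * (ω : ℂ)) * (f ω : ℂ) := by
  refine hf.ofReal.bdd_mul (c := 1) (by fun_prop) (ae_of_all _ fun ω => ?_)
  rw [mul_assoc, ← Complex.ofReal_mul, mul_comm, Complex.norm_exp_ofReal_mul_I]

theorem integral_mul_eq_integral_cos [IsProbabilityMeasure P] {Y : ℝ → Ω → ℝ} {f : ℝ → ℝ}
    (hY : ∀ t, MemLp (Y t) 2 P) (hY0 : ∀ t, ∫ w, Y t w ∂P = 0) (hf : IsSpectralDensity Y f P)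
    (s t : ℝ) : ∫ w, Y s w * Y t w ∂P = ∫ ω, Real.cos ((s - t) * ω) * f ω := by
  have h := congrArg Complex.re (hf.covariance_eq t (s - t))
  rw [add_sub_cancel, Complex.ofReal_re, covariance_eq_sub (hY s) (hY t), hY0, zero_mul,
    sub_zero] at h
  refine h.trans ?_
  rw [← RCLike.re_eq_complex_re, ← integral_re (integrable_exp_mul hf.integrable _)]
  refine integral_congr_ae (ae_of_all _ fun ω => ?_)
  simp only [RCLike.re_eq_complex_re]
  rw [Complex.re_mul_ofReal, mul_assoc, ← Complex.ofReal_mul, mul_comm Complex.I,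
    Complex.exp_ofReal_mul_I_re]

theorem norm_sum_exp_sq (c : ℕ → ℝ) (N : ℕ) (x : ℝ) :
    ‖∑ j ∈ Finset.range N, (c j : ℂ) * Complex.exp (Complex.I * x) ^ j‖ ^ 2 =
      ∑ i ∈ Finset.range N, ∑ j ∈ Finset.range N, c i * c j * Real.cos (((j : ℝ) - i) * x) := by
  have h : ∀ j : ℕ, (c j : ℂ) * Complex.exp (Complex.I * x) ^ j =
      c j * Complex.exp (((j * x : ℝ) : ℂ) * Complex.I) := fun j => by
    rw [← Complex.exp_nat_mul]
    push_cast
    ring_nf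
  rw [← Complex.normSq_eq_norm_sq, Complex.normSq_apply]
  simp only [h, Complex.re_sum, Complex.im_sum, Complex.re_ofReal_mul, Complex.im_ofReal_mul,
    Complex.exp_ofReal_mul_I_re, Complex.exp_ofReal_mul_I_im]
  rw [Finset.sum_mul_sum, Finset.sum_mul_sum, ← Finset.sum_add_distrib]
  refine Finset.sum_congr rfl fun i _ => ?_
  rw [← Finset.sum_add_distrib]
  refine Finset.sum_congr rfl fun j _ => ?_
  rw [sub_mul, Real.cos_sub]
  ring

/-- The second moment of a finite linear combination of equidistant observations. -/
theorem integral_sum_sq_eq [IsProbabilityMeasure P] {Y : ℝ → Ω → ℝ} {f : ℝ → ℝ}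
    (hY : ∀ t, MemLp (Y t) 2 P) (hY0 : ∀ t, ∫ w, Y t w ∂P = 0) (hf : IsSpectralDensity Y f P)
    (c : ℕ → ℝ) (Δ : ℝ) (n : ℤ) (N : ℕ) :
    ∫ w, (∑ j ∈ Finset.range N, c j * sampled Y Δ (n - j) w) ^ 2 ∂P =
      ∫ ω, ‖∑ j ∈ Finset.range N, (c j : ℂ) *
        Complex.exp (Complex.I * ((Δ * ω : ℝ) : ℂ)) ^ j‖ ^ 2 * f ω := by
  have hcos : ∀ a : ℝ, Integrable fun ω => Real.cos (a * ω) * f ω := fun a =>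
    hf.integrable.bdd_mul (c := 1) (by fun_prop) (ae_of_all _ fun ω => Real.abs_cos_le_one _)
  have hL : ∀ w, (∑ j ∈ Finset.range N, c j * sampled Y Δ (n - j) w) ^ 2 =
      ∑ i ∈ Finset.range N, ∑ j ∈ Finset.range N,
        c i * c j * (sampled Y Δ (n - i) w * sampled Y Δ (n - j) w) := fun w => by
    rw [sq, Finset.sum_mul_sum]
    exact Finset.sum_congr rfl fun i _ => Finset.sum_congr rfl fun j _ => by ring
  have hR : ∀ ω, ‖∑ j ∈ Finset.range N, (c j : ℂ) *
        Complex.exp (Complex.I * ((Δ * ω : ℝ) : ℂ)) ^ j‖ ^ 2 * f ω =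
      ∑ i ∈ Finset.range N, ∑ j ∈ Finset.range N,
        c i * c j * (Real.cos (((j : ℝ) - i) * Δ * ω) * f ω) := fun ω => by
    rw [norm_sum_exp_sq, Finset.sum_mul]
    refine Finset.sum_congr rfl fun i _ => ?_
    rw [Finset.sum_mul]
    exact Finset.sum_congr rfl fun j _ => by ring_nf
  have hint : ∀ i j : ℤ, Integrable (fun w => sampled Y Δ i w * sampled Y Δ j w) P :=
    fun i j => (hY _).integrable_mul (hY _)
  simp only [hL, hR]
  rw [integral_finsetSum _ fun i _ => integrable_finsetSum _ fun j _ => (hint _ _).const_mul _,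
    integral_finsetSum _ fun i _ => integrable_finsetSum _ fun j _ => (hcos _).const_mul _]
  refine Finset.sum_congr rfl fun i _ => ?_
  rw [integral_finsetSum _ fun j _ => (hint _ _).const_mul _,
    integral_finsetSum _ fun j _ => (hcos _).const_mul _]
  refine Finset.sum_congr rfl fun j _ => ?_
  rw [integral_const_mul, integral_const_mul]
  simp only [sampled]
  rw [integral_mul_eq_integral_cos hY hY0 hf]
  push_cast
  ring_nf

theorem fracDiff_memLp_and_tendsto [IsProbabilityMeasure P] {Y : ℝ → Ω → ℝ} {f : ℝ → ℝ}
    (hY : ∀ t, MemLp (Y t) 2 P) (hY0 : ∀ t, ∫ w, Y t w ∂P = 0) (hf : IsSpectralDensity Y f P)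
    {p : ℝ} (hp : 0 < p) (Δ : ℝ) (n : ℤ) :
    MemLp (fracDiff p (sampled Y Δ) n) 2 P ∧
      Tendsto (fun N : ℕ => eLpNorm (fun w =>
        fracDiffPartial p (sampled Y Δ) N n w - fracDiff p (sampled Y Δ) n w) 2 P)
        atTop (𝓝 0) := by
  -- Every `Y t` has second moment `∫ f`, so the terms of the series are bounded by `|c_j|` times
  -- one constant.
  have hnorm : ∀ t, eLpNorm (Y t) 2 P = eLpNorm (Y 0) 2 P := fun t => by
    have h : ∫ w, Y t w * Y t w ∂P = ∫ w, Y 0 w * Y 0 w ∂P := by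
      rw [integral_mul_eq_integral_cos hY hY0 hf, integral_mul_eq_integral_cos hY hY0 hf]
      simp
    rw [(hY t).eLpNorm_eq_integral_rpow_norm two_ne_zero (by norm_num),
      (hY 0).eLpNorm_eq_integral_rpow_norm two_ne_zero (by norm_num)]
    simp only [ENNReal.toReal_ofNat, Real.rpow_ofNat, Real.norm_eq_abs, sq_abs]
    simp only [sq, h]
  exact memLp_tsum_and_tendsto
    (y := fun j w => (-1) ^ j * Ring.choose p j * sampled Y Δ (n - j) w)
    (fun j => (hY _).const_mul _)
    (tsum_eLpNorm_const_mul_ne_top (hY 0).2.ne (summable_abs_diffCoeff hp)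
      fun j => (hnorm _).le)

/-- The spectral representation of the second moment of the fractional difference. -/
theorem integral_fracDiff_sq [IsProbabilityMeasure P] {Y : ℝ → Ω → ℝ} {f : ℝ → ℝ}
    (hY : ∀ t, MemLp (Y t) 2 P) (hY0 : ∀ t, ∫ w, Y t w ∂P = 0) (hf : IsSpectralDensity Y f P)
    {p : ℝ} (hp : 0 < p) (Δ : ℝ) (n : ℤ) :
    ∫ w, fracDiff p (sampled Y Δ) n w ^ 2 ∂P =
      2 ^ p * ∫ ω, (1 - Real.cos (Δ * ω)) ^ p * f ω := by
  obtain ⟨hmem, hlim⟩ := fracDiff_memLp_and_tendsto hY hY0 hf hp Δ n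
  have hS : ∀ N, MemLp (fracDiffPartial p (sampled Y Δ) N n) 2 P := fun N =>
    memLp_finsetSum _ fun j _ => (hY _).const_mul _
  have h1 := tendsto_integral_sq hS hmem hlim
  have hc := summable_abs_diffCoeff hp
  have hterm : ∀ (ω : ℝ) (j : ℕ), ‖(((-1) ^ j * Ring.choose p j : ℝ) : ℂ) *
      Complex.exp (Complex.I * ((Δ * ω : ℝ) : ℂ)) ^ j‖ = |(-1) ^ j * Ring.choose p j| :=
    fun ω j => by
      rw [norm_mul, norm_pow, mul_comm Complex.I, Complex.norm_exp_ofReal_mul_I, one_pow, mul_one,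
        Complex.norm_real, Real.norm_eq_abs]
  have h2 : Tendsto (fun N : ℕ => ∫ w, fracDiffPartial p (sampled Y Δ) N n w ^ 2 ∂P) atTop
      (𝓝 (∫ ω, 2 ^ p * ((1 - Real.cos (Δ * ω)) ^ p * f ω))) := by
    unfold fracDiffPartial
    simp only [integral_sum_sq_eq hY hY0 hf (fun j => (-1) ^ j * Ring.choose p j)]
    refine tendsto_integral_filter_of_dominated_convergence
      (fun ω => (∑' j : ℕ, |(-1) ^ j * Ring.choose p j|) ^ 2 * ‖f ω‖)
      (Eventually.of_forall fun N => ?_) (Eventually.of_forall fun N => ae_of_all _ fun ω => ?_)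
      (hf.integrable.norm.const_mul _) (ae_of_all _ fun ω => ?_)
    · refine AEStronglyMeasurable.mul ?_ hf.integrable.1
      exact Continuous.aestronglyMeasurable (by fun_prop)
    · rw [norm_mul, norm_pow, norm_norm]
      refine mul_le_mul_of_nonneg_right (pow_le_pow_left₀ (norm_nonneg _) ?_ 2) (norm_nonneg _)
      refine (norm_sum_le _ _).trans ?_
      simp only [hterm]
      exact hc.sum_le_tsum _ fun _ _ => abs_nonneg _
    · rw [← mul_assoc, ← norm_one_sub_exp_rpow, ← norm_tsum_diffCoeff hp (by
        rw [mul_comm, Complex.norm_exp_ofReal_mul_I])]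
      refine Tendsto.mul_const _ (Tendsto.pow (Tendsto.norm ?_) 2)
      exact (Summable.of_norm (by simpa only [hterm] using hc)).hasSum.tendsto_sum_nat
  rw [tendsto_nhds_unique h1 h2, integral_const_mul]

end MeanSquare

/-! ### Slowly varying functions -/

/-- The measure of the set of `v ∈ [0, 2]` for which `h (t + v) - h t` is not small vanishes. -/
theorem tendsto_volume_increment {h : ℝ → ℝ} (hm : Measurable h)
    (hh : ∀ u : ℝ, Tendsto (fun t => h (t + u) - h t) atTop (𝓝 0)) {ε : ℝ} (hε : 0 < ε) :
    Tendsto (fun t => volume.restrict (Set.Icc (0 : ℝ) 2) {v | ε ≤ |h (t + v) - h t|})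
      atTop (𝓝 0) := by
  -- Along sequences, pointwise convergence on the finite measure space `[0, 2]` implies convergence
  -- in measure.
  refine tendsto_of_seq_tendsto fun x hx => ?_
  have := tendstoInMeasure_of_tendsto_ae (μ := volume.restrict (Set.Icc (0 : ℝ) 2))
    (f := fun n v => h (x n + v) - h (x n)) (g := fun _ => 0)
    (fun n => ((hm.comp (measurable_const.add measurable_id)).sub
      measurable_const).aestronglyMeasurable)
    (ae_of_all _ fun v => (hh v).comp hx)
  rw [tendstoInMeasure_iff_norm] at this
  simpa [Function.comp_def] using this ε hε

/-- The uniform convergence theorem for additively slowly varying functions. -/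
theorem exists_uniform_increment {h : ℝ → ℝ} (hm : Measurable h)
    (hh : ∀ u : ℝ, Tendsto (fun t => h (t + u) - h t) atTop (𝓝 0)) {ε : ℝ} (hε : 0 < ε) :
    ∃ T : ℝ, ∀ t, T ≤ t → ∀ u ∈ Set.Icc (0 : ℝ) 1, |h (t + u) - h t| ≤ ε := by
  have h1 := (tendsto_volume_increment hm hh (half_pos hε)).eventually
    (gt_mem_nhds (show (0 : ENNReal) < ENNReal.ofReal (1 / 2) by simp))
  obtain ⟨T, hT⟩ := eventually_atTop.1 h1
  refine ⟨T, fun t ht u hu => ?_⟩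
  by_contra hlt
  push Not at hlt
  -- If `h (t + u)` and `h t` differ by more than `ε`, every value `h (t + v)` is at least `ε / 2`
  -- away from one of them. So `A` and the translate of `B` by `u` cover `[1, 2]`, yet each has
  -- measure below `1 / 2` in the window. The window `[0, 2]` contains both `v` and `v - u`.
  set A : Set ℝ := {v | ε / 2 ≤ |h (t + v) - h t|} with hA
  set B : Set ℝ := {v | ε / 2 ≤ |h (t + u + v) - h (t + u)|} with hB
  have hA1 : volume (A ∩ Set.Icc 0 2) < ENNReal.ofReal (1 / 2) := by
    rw [← Measure.restrict_apply' measurableSet_Icc]; exact hT t ht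
  have hB1 : volume (B ∩ Set.Icc 0 2) < ENNReal.ofReal (1 / 2) := by
    rw [← Measure.restrict_apply' measurableSet_Icc]; exact hT (t + u) (by linarith [hu.1])
  have hsub : Set.Icc (1 : ℝ) 2 ⊆ (A ∩ Set.Icc 0 2) ∪ (fun x => x + -u) ⁻¹' (B ∩ Set.Icc 0 2) := by
    intro v hv
    by_cases hvA : v ∈ A
    · exact Or.inl ⟨hvA, by constructor <;> linarith [hv.1, hv.2]⟩
    · refine Or.inr ⟨?_, by constructor <;> linarith [hv.1, hv.2, hu.1, hu.2]⟩
      simp only [hA, Set.mem_ofPred_eq, not_le] at hvA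
      simp only [hB, Set.mem_ofPred_eq]
      rw [show t + u + (v + -u) = t + v by ring]
      have := abs_sub_le (h (t + u)) (h (t + v)) (h t)
      rw [abs_sub_comm (h (t + u)) (h (t + v))] at this
      linarith
  have h2 := (measure_mono hsub).trans (measure_union_le (μ := volume) _ _)
  rw [measure_preimage_add_right, Real.volume_Icc] at h2
  have h3 := h2.trans_lt (ENNReal.add_lt_add hA1 hB1)
  rw [← ENNReal.ofReal_add (by norm_num) (by norm_num)] at h3
  norm_num at h3

/-- Each unit step costs at most `ε`, and the leftover fractional step one more; this is the `1` in
the bound. -/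
theorem exists_linear_increment {h : ℝ → ℝ} (hm : Measurable h)
    (hh : ∀ u : ℝ, Tendsto (fun t => h (t + u) - h t) atTop (𝓝 0)) {ε : ℝ} (hε : 0 < ε) :
    ∃ T : ℝ, ∀ t s, T ≤ t → T ≤ s → |h s - h t| ≤ ε * (1 + |s - t|) := by
  obtain ⟨T, hT⟩ := exists_uniform_increment hm hh hε
  have hnat : ∀ (n : ℕ) (t : ℝ), T ≤ t → |h (t + n) - h t| ≤ ε * n := by
    intro n
    induction n with
    | zero => simp
    | succ n ih =>
      intro t ht
      have h1 := hT (t + n) (by linarith [Nat.cast_nonneg (α := ℝ) n]) 1 (by simp)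
      have h2 := abs_sub_le (h (t + n + 1)) (h (t + n)) (h t)
      push_cast
      rw [← add_assoc]
      linarith [ih t ht]
  have hle : ∀ t s, T ≤ t → t ≤ s → |h s - h t| ≤ ε * (1 + |s - t|) := fun t s ht hts => by
    have hn := Nat.floor_le (sub_nonneg.2 hts)
    have hn' := Nat.lt_floor_add_one (s - t)
    set n := ⌊s - t⌋₊
    have h1 := hT (t + n) (by linarith [Nat.cast_nonneg (α := ℝ) n]) (s - t - n)
      ⟨by linarith, by linarith⟩
    rw [show t + n + (s - t - n) = s by ring] at h1
    have h2 := abs_sub_le (h s) (h (t + n)) (h t)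
    have h3 := hnat n t ht
    have h4 : ε * n ≤ ε * |s - t| :=
      mul_le_mul_of_nonneg_left (hn.trans (le_abs_self _)) hε.le
    linarith
  refine ⟨T, fun t s ht hs => ?_⟩
  rcases le_total t s with hts | hts
  · exact hle t s ht hts
  · rw [abs_sub_comm, abs_sub_comm s]
    exact hle s t hs hts

theorem IsRegularlyVarying.measurable_comp_exp {ρ : ℝ} {ℓ : ℝ → ℝ} (hℓ : IsRegularlyVarying ρ ℓ) :
    Measurable fun t : ℝ => ℓ (Real.exp t) :=
  hℓ.measurable.comp
    (Real.measurable_exp.subtype_mk (h := fun t => Set.mem_Ioi.2 (Real.exp_pos t)))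

/-- Potter's bound. -/
theorem IsRegularlyVarying.exists_potter_bound {ℓ : ℝ → ℝ} (hℓ : IsRegularlyVarying 0 ℓ)
    {ε : ℝ} (hε : 0 < ε) :
    ∃ X : ℝ, 0 < X ∧ ∀ x y, X ≤ x → X ≤ y →
      ℓ y / ℓ x ≤ Real.exp ε * ((y / x) ^ ε + (y / x) ^ (-ε)) := by
  -- In logarithmic coordinates slow variation becomes additive, and `exp (ε (1 + |log r|))` is
  -- `e^ε` times the larger of `r^ε` and `r^{-ε}`.
  have hm : Measurable fun t : ℝ => Real.log (ℓ (Real.exp t)) :=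
    Real.measurable_log.comp hℓ.measurable_comp_exp
  have hh : ∀ u : ℝ, Tendsto (fun t => Real.log (ℓ (Real.exp (t + u))) - Real.log (ℓ (Real.exp t)))
      atTop (𝓝 0) := fun u => by
    have h1 := (hℓ.tendsto (Real.exp u) (Real.exp_pos u)).comp Real.tendsto_exp_atTop
    rw [Real.rpow_zero] at h1
    have h2 := h1.log one_ne_zero
    rw [Real.log_one] at h2
    refine h2.congr fun t => ?_
    simp only [Function.comp_apply]
    rw [← Real.exp_add, add_comm u,
      Real.log_div (hℓ.pos _ (Real.exp_pos _)).ne' (hℓ.pos _ (Real.exp_pos _)).ne']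
  obtain ⟨T, hT⟩ := exists_linear_increment hm hh hε
  refine ⟨Real.exp T, Real.exp_pos T, fun x y hx hy => ?_⟩
  have hx0 : 0 < x := (Real.exp_pos T).trans_le hx
  have hy0 : 0 < y := (Real.exp_pos T).trans_le hy
  have h1 := hT (Real.log x) (Real.log y) ((Real.le_log_iff_exp_le hx0).2 hx)
    ((Real.le_log_iff_exp_le hy0).2 hy)
  rw [Real.exp_log hx0, Real.exp_log hy0, ← Real.log_div hy0.ne' hx0.ne',
    ← Real.log_div (hℓ.pos _ hy0).ne' (hℓ.pos _ hx0).ne'] at h1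
  have hr : 0 < y / x := div_pos hy0 hx0
  rw [← Real.exp_log (div_pos (hℓ.pos _ hy0) (hℓ.pos _ hx0))]
  refine (Real.exp_le_exp.2 ((le_abs_self _).trans h1)).trans ?_
  rw [mul_add, mul_one, Real.exp_add]
  refine mul_le_mul_of_nonneg_left ?_ (Real.exp_pos _).le
  rw [Real.rpow_def_of_pos hr, Real.rpow_def_of_pos hr]
  rcases abs_cases (Real.log (y / x)) with ⟨h, -⟩ | ⟨h, -⟩
  · rw [h, mul_comm]
    exact le_add_of_nonneg_right (Real.exp_pos _).le
  · rw [h, mul_comm, neg_mul_comm]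
    simp only [mul_neg]
    exact le_add_of_nonneg_left (Real.exp_pos _).le

/-! ### The constant -/

/-- The function `u ↦ (1 - cos u)^p |u|^{-α}`. -/
noncomputable def diffKernel (p α u : ℝ) : ℝ := (1 - Real.cos u) ^ p * |u| ^ (-α)

theorem one_sub_cos_nonneg (u : ℝ) : 0 ≤ 1 - Real.cos u := sub_nonneg.2 (Real.cos_le_one u)

theorem diffKernel_nonneg (p α u : ℝ) : 0 ≤ diffKernel p α u :=
  mul_nonneg (Real.rpow_nonneg (one_sub_cos_nonneg u) _) (Real.rpow_nonneg (abs_nonneg u) _)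

theorem measurable_diffKernel (p α : ℝ) : Measurable (diffKernel p α) := by
  unfold diffKernel
  fun_prop

theorem one_sub_cos_rpow_le {p : ℝ} (hp : 0 ≤ p) (u : ℝ) :
    (1 - Real.cos u) ^ p ≤ |u| ^ (2 * p) := by
  rw [Real.rpow_mul (abs_nonneg u), Real.rpow_ofNat, sq_abs]
  exact Real.rpow_le_rpow (one_sub_cos_nonneg u)
    (by nlinarith [Real.one_sub_sq_div_two_le_cos (x := u), sq_nonneg u]) hp

theorem one_sub_cos_rpow_le_two {p : ℝ} (hp : 0 ≤ p) (u : ℝ) :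
    (1 - Real.cos u) ^ p ≤ 2 ^ p :=
  Real.rpow_le_rpow (one_sub_cos_nonneg u) (by linarith [Real.neg_one_le_cos u]) hp

/-- Near `0` the kernel is at most `|u|^{2p - α}` with `2p - α > -1`; at infinity it is at most `2^p
|u|^{-α}` with `α > 1`. -/
theorem integrable_diffKernel {p α : ℝ} (hα : 1 < α) (hαp : α < 2 * p + 1) :
    Integrable (diffKernel p α) := by
  have hp : 0 ≤ p := by linarith
  have h1 : IntegrableOn (diffKernel p α) (Set.Ioc 0 1) := by
    have h := (intervalIntegral.intervalIntegrable_rpow' (a := 0) (b := 1)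
      (show -1 < 2 * p - α by linarith)).1
    refine Integrable.mono' h (measurable_diffKernel p α).aestronglyMeasurable ?_
    filter_upwards [ae_restrict_mem measurableSet_Ioc] with u hu
    rw [Real.norm_of_nonneg (diffKernel_nonneg _ _ _), Real.rpow_sub hu.1, div_eq_mul_inv,
      ← Real.rpow_neg hu.1.le, diffKernel]
    have h2 := one_sub_cos_rpow_le hp u
    rw [abs_of_pos hu.1] at h2 ⊢
    exact mul_le_mul_of_nonneg_right h2 (Real.rpow_nonneg hu.1.le _)
  have h2 : IntegrableOn (diffKernel p α) (Set.Ioi 1) := by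
    have h := ((integrableOn_Ioi_rpow_of_lt (show -α < -1 by linarith) one_pos).const_mul
      ((2 : ℝ) ^ p))
    refine Integrable.mono' h (measurable_diffKernel p α).aestronglyMeasurable ?_
    filter_upwards [ae_restrict_mem measurableSet_Ioi] with u hu
    rw [Real.norm_of_nonneg (diffKernel_nonneg _ _ _), diffKernel,
      abs_of_pos (one_pos.trans hu)]
    exact mul_le_mul_of_nonneg_right (one_sub_cos_rpow_le_two hp u)
      (Real.rpow_nonneg (one_pos.trans hu).le _)
  have h3 : IntegrableOn (diffKernel p α) (Set.Ioi 0) := by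
    rw [← Set.Ioc_union_Ioi_eq_Ioi (zero_le_one (α := ℝ))]
    exact h1.union h2
  have h4 : IntegrableOn (diffKernel p α) (Set.Iio 0) := by
    have h := ((Measure.measurePreserving_neg (volume : Measure ℝ)).integrableOn_comp_preimage
      (MeasurableEquiv.neg ℝ).measurableEmbedding).2 h3
    have he : diffKernel p α ∘ Neg.neg = diffKernel p α := by
      funext u; simp [diffKernel]
    simpa [he] using h
  rw [← integrableOn_univ, ← Set.Iic_union_Ioi (a := (0 : ℝ))]
  refine IntegrableOn.union ?_ h3
  rwa [integrableOn_Iic_iff_integrableOn_Iio]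

theorem integral_diffKernel_pos {p α : ℝ} (hα : 1 < α) (hαp : α < 2 * p + 1) :
    0 < ∫ u, diffKernel p α u := by
  rw [integral_pos_iff_support_of_nonneg (diffKernel_nonneg p α) (integrable_diffKernel hα hαp)]
  refine lt_of_lt_of_le ?_ (measure_mono (show Set.Ioo (0 : ℝ) 1 ⊆ _ from fun u hu => ?_))
  · simp
  · have hc : Real.cos u < 1 := by
      rw [← Real.cos_zero]
      exact Real.cos_lt_cos_of_nonneg_of_le_pi le_rfl (by linarith [hu.2, Real.pi_gt_three]) hu.1
    exact (mul_pos (Real.rpow_pos_of_pos (sub_pos.2 hc) _)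
      (Real.rpow_pos_of_pos (abs_pos.2 hu.1.ne') _)).ne'

theorem diffKernel_add_int (p α u : ℝ) (n : ℤ) :
    diffKernel p α (u + 2 * Real.pi * n) =
      (1 - Real.cos u) ^ p * |u + 2 * Real.pi * n| ^ (-α) := by
  rw [diffKernel, mul_comm (2 * Real.pi), Real.cos_add_int_mul_two_pi]

theorem hasSum_integral_diffKernel {p α : ℝ} (hα : 1 < α) (hαp : α < 2 * p + 1) :
    HasSum (fun n : ℤ => ∫ u in (-Real.pi)..Real.pi, diffKernel p α (u + 2 * Real.pi * n))
      (∫ u, diffKernel p α u) := by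
  have hπ : (2 * Real.pi) ≠ 0 := by positivity
  -- The line is cut into unit intervals, hence the rescaling by `2π`; the offset `-1/2` becomes the
  -- endpoint `-π`.
  have h := (((integrable_diffKernel hα hαp).comp_mul_left' hπ).hasSum_intervalIntegral
    (-1 / 2)).mul_left (2 * Real.pi)
  rw [Measure.integral_comp_mul_left, abs_of_pos (by positivity), smul_eq_mul, ← mul_assoc,
    mul_inv_cancel₀ hπ, one_mul] at h
  refine h.congr_fun fun n => ?_
  rw [intervalIntegral.integral_comp_mul_left _ hπ, smul_eq_mul, ← mul_assoc,
    mul_inv_cancel₀ hπ, one_mul, intervalIntegral.integral_comp_add_right]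
  congr 1 <;> ring

theorem summable_abs_add_rpow {α : ℝ} (hα : 1 < α) (u : ℝ) :
    Summable fun k : ℕ => |u + 2 * Real.pi * (k + 1)| ^ (-α) := by
  have h := (((Real.summable_one_div_nat_add_rpow (1 + u / (2 * Real.pi)) α).2 hα).mul_left
    ((2 * Real.pi) ^ (-α)))
  refine h.congr fun k => ?_
  have hπ : 0 < 2 * Real.pi := by positivity
  rw [one_div, ← Real.rpow_neg (abs_nonneg _), ← Real.mul_rpow hπ.le (abs_nonneg _)]
  congr 1
  nth_rw 1 [← abs_of_pos hπ]
  rw [← abs_mul]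
  congr 1
  field_simp
  ring

theorem tsum_abs_add_rpow {α u : ℝ} (hu : -(2 * Real.pi) < u) :
    ∑' k : ℕ, |u + 2 * Real.pi * (k + 1)| ^ (-α) =
      (2 * Real.pi) ^ (-α) * realHurwitzZeta α (1 + u / (2 * Real.pi)) := by
  have hπ : 0 < 2 * Real.pi := by positivity
  rw [realHurwitzZeta, ← tsum_mul_left]
  refine tsum_congr fun k => ?_
  have h1 : -1 < u / (2 * Real.pi) := by rw [lt_div_iff₀ hπ]; linarith
  have h2 : 0 < 1 + u / (2 * Real.pi) + k := by linarith [Nat.cast_nonneg (α := ℝ) k]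
  have h3 : u + 2 * Real.pi * (k + 1) = (2 * Real.pi) * (1 + u / (2 * Real.pi) + k) := by
    field_simp
    ring
  rw [h3, abs_of_pos (mul_pos hπ h2), Real.mul_rpow hπ.le h2.le, Real.rpow_neg h2.le, one_div]

/-- The index `n = 0` gives `|u|^{-α}`, and the positive and negative indices give one zeta value
each. The condition on `u` keeps both zeta arguments positive. -/
theorem tsum_diffKernel_add_int {p α u : ℝ} (hα : 1 < α) (hu : |u| < 2 * Real.pi) :
    ∑' n : ℤ, diffKernel p α (u + 2 * Real.pi * n) =
      (1 - Real.cos u) ^ p * hurwitzBracket α u := by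
  have hneg : ∀ k : ℕ, |u + 2 * Real.pi * ((-((k : ℤ) + 1) : ℤ) : ℝ)| =
      |-u + 2 * Real.pi * (k + 1)| := fun k => by
    rw [← abs_neg]
    congr 1
    push_cast
    ring
  have hsum : ∑' n : ℤ, |u + 2 * Real.pi * n| ^ (-α) = hurwitzBracket α u := by
    rw [tsum_of_add_one_of_neg_add_one (f := fun n : ℤ => |u + 2 * Real.pi * n| ^ (-α))]
    · simp only [hneg]
      push_cast
      rw [tsum_abs_add_rpow (neg_lt_of_abs_lt hu), tsum_abs_add_rpow (by
        linarith [lt_of_abs_lt hu]), hurwitzBracket]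
      simp only [mul_zero, add_zero, neg_div, ← sub_eq_add_neg]
      ring
    · simpa using summable_abs_add_rpow hα u
    · simpa only [hneg] using summable_abs_add_rpow hα (-u)
  simp only [diffKernel_add_int]
  rw [tsum_mul_left, hsum]

theorem integral_diffKernel_eq {p α : ℝ} (hα : 1 < α) (hαp : α < 2 * p + 1) :
    ∫ u, diffKernel p α u = incrementConst p α := by
  have h := hasSum_integral_diffKernel hα hαp
  have hle : -Real.pi ≤ Real.pi := by linarith [Real.pi_pos]
  simp only [intervalIntegral.integral_of_le hle] at h
  rw [← h.tsum_eq, incrementConst, intervalIntegral.integral_of_le hle,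
    integral_tsum_of_summable_integral_norm]
  · refine setIntegral_congr_fun measurableSet_Ioc fun u hu => ?_
    exact tsum_diffKernel_add_int hα
      (abs_lt.2 ⟨by linarith [hu.1, Real.pi_pos], by linarith [hu.2, Real.pi_pos]⟩)
  · exact fun n => ((integrable_diffKernel hα hαp).comp_add_right _).integrableOn
  · simpa only [Real.norm_of_nonneg (diffKernel_nonneg _ _ _)] using h.summable

/-! ### Asymptotics of the spectral integral -/

/-- Potter's factors only shift `α` by `±ε`, so the dominating function is again a sum of kernels of
the same type. -/
theorem diffKernel_mul_rpow (p α ε : ℝ) {u : ℝ} (hu : u ≠ 0) :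
    (|u| ^ ε + |u| ^ (-ε)) * diffKernel p α u =
      diffKernel p (α - ε) u + diffKernel p (α + ε) u := by
  have h0 := abs_pos.2 hu
  simp only [diffKernel]
  rw [show -(α - ε) = -α + ε by ring, show -(α + ε) = -α + -ε by ring, Real.rpow_add h0,
    Real.rpow_add h0]
  ring

/-- The integrand of the high frequency part after the substitution `u = Δ ω`. -/
noncomputable def scaledKernel (p α X : ℝ) (ℓ : ℝ → ℝ) (Δ u : ℝ) : ℝ :=
  {ω : ℝ | X ≤ |ω|}.indicator (fun ω => ℓ |ω|) (Δ⁻¹ * u) / ℓ Δ⁻¹ * diffKernel p α u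

theorem measurableSet_le_abs (X : ℝ) : MeasurableSet {ω : ℝ | X ≤ |ω|} :=
  measurableSet_le measurable_const measurable_norm

theorem measurable_scaledKernel (p α : ℝ) {X : ℝ} (hX : 0 < X) {ρ : ℝ} {ℓ : ℝ → ℝ}
    (hℓ : IsRegularlyVarying ρ ℓ) (Δ : ℝ) : Measurable (scaledKernel p α X ℓ Δ) := by
  have h1 : Measurable ({ω : ℝ | X ≤ |ω|}.indicator fun ω => ℓ |ω|) := by
    -- `ℓ` is measurable only on `(0, ∞)`; since `exp (log ω) = |ω|` for `ω ≠ 0`, the measurable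
    -- function `ℓ ∘ exp` can be used instead.
    have he : ({ω : ℝ | X ≤ |ω|}.indicator fun ω => ℓ |ω|) =
        {ω : ℝ | X ≤ |ω|}.indicator fun ω => ℓ (Real.exp (Real.log ω)) := by
      refine Set.indicator_congr fun ω hω => ?_
      have : ω ≠ 0 := abs_pos.1 (hX.trans_le hω)
      rw [Real.exp_log_eq_abs this]
    rw [he]
    exact (hℓ.measurable_comp_exp.comp Real.measurable_log).indicator (measurableSet_le_abs X)
  exact ((h1.comp (measurable_const.mul measurable_id)).div_const _).mul
    (measurable_diffKernel p α)

theorem setIntegral_high_eq {p α X : ℝ} (hX : 0 < X) {ρ : ℝ} {f ℓ : ℝ → ℝ}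
    (hℓ : IsRegularlyVarying ρ ℓ) (hfℓ : ∀ ω : ℝ, ω ≠ 0 → f ω = |ω| ^ (-α) * ℓ |ω|)
    {Δ : ℝ} (hΔ : 0 < Δ) :
    (∫ ω in {ω : ℝ | X ≤ |ω|}, (1 - Real.cos (Δ * ω)) ^ p * f ω) / (ℓ Δ⁻¹ * Δ ^ (α - 1)) =
      ∫ u, scaledKernel p α X ℓ Δ u := by
  have hl := hℓ.pos _ (inv_pos.2 hΔ)
  rw [← integral_indicator (measurableSet_le_abs X)]
  have h := Measure.integral_comp_mul_left
    ({ω : ℝ | X ≤ |ω|}.indicator fun ω => (1 - Real.cos (Δ * ω)) ^ p * f ω) Δ⁻¹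
  rw [inv_inv, abs_of_pos hΔ, smul_eq_mul, mul_comm, ← div_eq_iff hΔ.ne'] at h
  rw [← h, div_div, ← integral_div]
  refine integral_congr_ae (ae_of_all _ fun u => ?_)
  simp only [scaledKernel]
  by_cases hu : Δ⁻¹ * u ∈ {ω : ℝ | X ≤ |ω|}
  · have hu0 : Δ⁻¹ * u ≠ 0 := abs_pos.1 (hX.trans_le hu)
    rw [Set.indicator_of_mem hu, Set.indicator_of_mem hu, hfℓ _ hu0, mul_inv_cancel_left₀ hΔ.ne',
      diffKernel]
    have h1 : |Δ⁻¹ * u| ^ (-α) = Δ ^ α * |u| ^ (-α) := by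
      rw [abs_mul, abs_of_pos (inv_pos.2 hΔ), Real.mul_rpow (inv_pos.2 hΔ).le (abs_nonneg _),
        Real.inv_rpow hΔ.le, Real.rpow_neg hΔ.le, inv_inv]
    have h2 : Δ ^ α = Δ * Δ ^ (α - 1) := by
      rw [mul_comm, ← Real.rpow_add_one hΔ.ne', sub_add_cancel]
    have h3 : Δ ^ (α - 1) ≠ 0 := (Real.rpow_pos_of_pos hΔ _).ne'
    rw [h1, h2]
    field_simp
  · rw [Set.indicator_of_notMem hu, Set.indicator_of_notMem hu]
    simp

theorem tendsto_integral_scaledKernel {p α ε X : ℝ} (hε : 0 < ε) (hα : 1 < α - ε)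
    (hαp : α + ε < 2 * p + 1) (hX : 0 < X) {ℓ : ℝ → ℝ} (hℓ : IsRegularlyVarying 0 ℓ)
    (hpot : ∀ x y, X ≤ x → X ≤ y →
      ℓ y / ℓ x ≤ Real.exp ε * ((y / x) ^ ε + (y / x) ^ (-ε))) :
    Tendsto (fun Δ => ∫ u, scaledKernel p α X ℓ Δ u) (𝓝[>] 0) (𝓝 (∫ u, diffKernel p α u)) := by
  have hne : ∀ᵐ u : ℝ, u ≠ 0 := Measure.ae_ne volume 0
  refine tendsto_integral_filter_of_dominated_convergence
    (fun u => Real.exp ε * (diffKernel p (α - ε) u + diffKernel p (α + ε) u))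
    (Eventually.of_forall fun Δ => (measurable_scaledKernel p α hX hℓ Δ).aestronglyMeasurable)
    ?_ (((integrable_diffKernel hα (by linarith)).add
      (integrable_diffKernel (by linarith) hαp)).const_mul _) ?_
  · filter_upwards [Ioo_mem_nhdsGT (inv_pos.2 hX)] with Δ hΔ
    have hΔX : X ≤ Δ⁻¹ := (le_inv_comm₀ hX hΔ.1).2 hΔ.2.le
    have hl := hℓ.pos _ (inv_pos.2 hΔ.1)
    filter_upwards [hne] with u hu
    rw [← diffKernel_mul_rpow p α ε hu, ← mul_assoc, scaledKernel, norm_mul,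
      Real.norm_of_nonneg (diffKernel_nonneg _ _ _)]
    refine mul_le_mul_of_nonneg_right ?_ (diffKernel_nonneg _ _ _)
    by_cases hm : Δ⁻¹ * u ∈ {ω : ℝ | X ≤ |ω|}
    · rw [Set.indicator_of_mem hm,
        Real.norm_of_nonneg (div_pos (hℓ.pos _ (hX.trans_le hm)) hl).le]
      have h := hpot _ _ hΔX hm
      have hq : |Δ⁻¹ * u| / Δ⁻¹ = |u| := by
        rw [abs_mul, abs_of_pos (inv_pos.2 hΔ.1), mul_div_cancel_left₀ _ (inv_pos.2 hΔ.1).ne']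
      rwa [hq] at h
    · rw [Set.indicator_of_notMem hm, zero_div, norm_zero]
      positivity
  · filter_upwards [hne] with u hu
    have h1 := ((hℓ.tendsto |u| (abs_pos.2 hu)).comp tendsto_inv_nhdsGT_zero).mul_const
      (diffKernel p α u)
    rw [Real.rpow_zero, one_mul] at h1
    refine h1.congr' ?_
    -- For fixed `u ≠ 0` the cutoff `X ≤ |u| / Δ` holds once `Δ` is small.
    filter_upwards [tendsto_inv_nhdsGT_zero.eventually (eventually_ge_atTop (X / |u|)),
      self_mem_nhdsWithin] with Δ hΔ hΔ0
    have he : |Δ⁻¹ * u| = |u| * Δ⁻¹ := by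
      rw [abs_mul, abs_of_pos (inv_pos.2 hΔ0), mul_comm]
    have hm : Δ⁻¹ * u ∈ {ω : ℝ | X ≤ |ω|} := by
      rw [Set.mem_ofPred_eq, he]
      exact (div_le_iff₀' (abs_pos.2 hu)).1 hΔ
    simp only [Function.comp_apply]
    rw [scaledKernel, Set.indicator_of_mem hm, he]

/-- The numerator is `O(Δ^{2p})`. Potter's bound between `1/Δ` and `X` keeps `ℓ(1/Δ)` from being too
small, which leaves powers of `XΔ` with exponents `2p + 1 - α ± ε`, both positive. -/
theorem tendsto_setIntegral_low {p α ε X : ℝ} (hp : 0 ≤ p) (hε : 0 < ε)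
    (hαp : α + ε < 2 * p + 1) (hX : 0 < X) {f ℓ : ℝ → ℝ} (hf : Integrable f)
    (hℓ : IsRegularlyVarying 0 ℓ)
    (hpot : ∀ x y, X ≤ x → X ≤ y →
      ℓ y / ℓ x ≤ Real.exp ε * ((y / x) ^ ε + (y / x) ^ (-ε))) :
    Tendsto (fun Δ => (∫ ω in {ω : ℝ | X ≤ |ω|}ᶜ, (1 - Real.cos (Δ * ω)) ^ p * f ω) /
      (ℓ Δ⁻¹ * Δ ^ (α - 1))) (𝓝[>] 0) (𝓝 0) := by
  set C : ℝ := (∫ ω, ‖f ω‖) * (Real.exp ε / ℓ X) * X ^ (α - 1) with hC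
  have hlX := hℓ.pos X hX
  have hbound : ∀ᶠ Δ : ℝ in 𝓝[>] 0,
      ‖(∫ ω in {ω : ℝ | X ≤ |ω|}ᶜ, (1 - Real.cos (Δ * ω)) ^ p * f ω) / (ℓ Δ⁻¹ * Δ ^ (α - 1))‖ ≤
      C * ((X * Δ) ^ (2 * p + 1 - α + ε) + (X * Δ) ^ (2 * p + 1 - α - ε)) := by
    filter_upwards [Ioo_mem_nhdsGT (inv_pos.2 hX)] with Δ hΔ
    have hΔ0 := hΔ.1
    have hΔX : X ≤ Δ⁻¹ := (le_inv_comm₀ hX hΔ0).2 hΔ.2.le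
    have hl := hℓ.pos _ (inv_pos.2 hΔ0)
    have hr : 0 < X * Δ := mul_pos hX hΔ0
    have hnum : ‖∫ ω in {ω : ℝ | X ≤ |ω|}ᶜ, (1 - Real.cos (Δ * ω)) ^ p * f ω‖ ≤
        (X * Δ) ^ (2 * p) * ∫ ω, ‖f ω‖ := by
      have h1 : ‖∫ ω in {ω : ℝ | X ≤ |ω|}ᶜ, (1 - Real.cos (Δ * ω)) ^ p * f ω‖ ≤
          ∫ ω in {ω : ℝ | X ≤ |ω|}ᶜ, (X * Δ) ^ (2 * p) * ‖f ω‖ := by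
        refine norm_integral_le_of_norm_le (hf.norm.const_mul _).integrableOn ?_
        filter_upwards [ae_restrict_mem (measurableSet_le_abs X).compl] with ω hω
        have hω' : |ω| < X := not_le.1 hω
        rw [norm_mul, Real.norm_of_nonneg (Real.rpow_nonneg (one_sub_cos_nonneg _) _)]
        refine mul_le_mul_of_nonneg_right ((one_sub_cos_rpow_le hp _).trans ?_) (norm_nonneg _)
        refine Real.rpow_le_rpow (abs_nonneg _) ?_ (by linarith)
        rw [abs_mul, abs_of_pos hΔ0, mul_comm]
        exact mul_le_mul_of_nonneg_right hω'.le hΔ0.le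
      refine h1.trans ?_
      rw [integral_const_mul]
      exact mul_le_mul_of_nonneg_left (setIntegral_le_integral hf.norm
        (ae_of_all _ fun _ => norm_nonneg _)) (Real.rpow_nonneg hr.le _)
    have hden : (ℓ Δ⁻¹)⁻¹ ≤ Real.exp ε / ℓ X * ((X * Δ) ^ ε + (X * Δ) ^ (-ε)) := by
      have h := hpot _ _ hΔX le_rfl
      rw [div_inv_eq_mul] at h
      rw [div_mul_eq_mul_div, le_div_iff₀ hlX, mul_comm, ← div_eq_mul_inv]
      exact h
    have hpow : (Δ ^ (α - 1))⁻¹ = X ^ (α - 1) * (X * Δ) ^ (1 - α) := by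
      rw [Real.mul_rpow hX.le hΔ0.le, ← mul_assoc, ← Real.rpow_add hX, ← Real.rpow_neg hΔ0.le]
      simp
    have hDpos := Real.rpow_pos_of_pos hΔ0 (α - 1)
    rw [norm_div, Real.norm_of_nonneg (mul_pos hl hDpos).le, div_eq_mul_inv, mul_inv]
    refine (mul_le_mul hnum (mul_le_mul_of_nonneg_right hden (inv_pos.2 hDpos).le)
      (by positivity) (by positivity)).trans (le_of_eq ?_)
    rw [hpow, hC, show 2 * p + 1 - α + ε = 2 * p + (1 - α) + ε by ring,
      show 2 * p + 1 - α - ε = 2 * p + (1 - α) + -ε by ring]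
    simp only [Real.rpow_add hr]
    ring
  refine squeeze_zero_norm' hbound ?_
  have hz : ∀ s : ℝ, 0 < s → Tendsto (fun Δ : ℝ => (X * Δ) ^ s) (𝓝[>] 0) (𝓝 0) := fun s hs => by
    have h : Continuous fun Δ : ℝ => (X * Δ) ^ s :=
      (continuous_const.mul continuous_id).rpow_const fun _ => Or.inr hs.le
    have h0 := h.tendsto 0
    rw [mul_zero, Real.zero_rpow hs.ne'] at h0
    exact h0.mono_left nhdsWithin_le_nhds
  simpa using ((hz _ (by linarith)).add (hz _ (by linarith))).const_mul C

theorem tendsto_integral_one_sub_cos {p α : ℝ} (hα : 1 < α) (hαp : α < 2 * p + 1)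
    {f ℓ : ℝ → ℝ} (hf : Integrable f) (hℓ : IsRegularlyVarying 0 ℓ)
    (hfℓ : ∀ ω : ℝ, ω ≠ 0 → f ω = |ω| ^ (-α) * ℓ |ω|) :
    Tendsto (fun Δ => (∫ ω, (1 - Real.cos (Δ * ω)) ^ p * f ω) / (ℓ Δ⁻¹ * Δ ^ (α - 1)))
      (𝓝[>] 0) (𝓝 (incrementConst p α)) := by
  have hp : 0 ≤ p := by linarith
  -- Chosen so that `α ± ε` still lie strictly between `1` and `2p + 1`.
  obtain ⟨ε, hε, hε'⟩ : ∃ ε, 0 < ε ∧ ε < min (α - 1) (2 * p + 1 - α) :=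
    exists_between (lt_min (by linarith) (by linarith))
  obtain ⟨hε1, hε2⟩ := lt_min_iff.1 hε'
  obtain ⟨X, hX, hpot⟩ := hℓ.exists_potter_bound hε
  have h1 := tendsto_integral_scaledKernel hε (by linarith) (by linarith) hX hℓ hpot
    (p := p) (α := α)
  have h2 := tendsto_setIntegral_low hp hε (by linarith) hX hf hℓ hpot (α := α)
  rw [← integral_diffKernel_eq hα hαp]
  have h3 := h1.add h2
  rw [add_zero] at h3
  refine h3.congr' ?_
  filter_upwards [self_mem_nhdsWithin] with Δ hΔ
  rw [← setIntegral_high_eq hX hℓ hfℓ hΔ, ← add_div, integral_add_compl (measurableSet_le_abs X)]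
  refine hf.bdd_mul (c := 2 ^ p) (by fun_prop) (ae_of_all _ fun ω => ?_)
  rw [Real.norm_of_nonneg (Real.rpow_nonneg (one_sub_cos_nonneg _) _)]
  exact one_sub_cos_rpow_le_two hp _

theorem corollary6p3 {Ω : Type*} [MeasurableSpace Ω] (P : Measure Ω) [IsProbabilityMeasure P]
    (L Y : ℝ → Ω → ℝ) (σ : ℝ) (g f ℓ : ℝ → ℝ)
    (hL : HasStationaryOrthogonalIncrements L σ P)
    (hY : IsCMAProcess Y g L P)
    (hf : IsSpectralDensity Y f P)
    (α p : ℝ) (hα : 1 < α) (hαp : α < 2 * p + 1)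
    (hℓ : IsRegularlyVarying 0 ℓ)
    (hfℓ : ∀ ω : ℝ, ω ≠ 0 → f ω = |ω| ^ (-α) * ℓ |ω|) :
    (∀ Δ : ℝ, 0 < Δ → ∀ n : ℤ,
      MemLp (fracDiff p (sampled Y Δ) n) 2 P ∧
      Tendsto (fun N : ℕ => eLpNorm (fun w =>
        fracDiffPartial p (sampled Y Δ) N n w - fracDiff p (sampled Y Δ) n w) 2 P)
        atTop (𝓝 0)) ∧
    ∀ n : ℤ, Tendsto (fun Δ : ℝ =>
      (∫ w, (fracDiff p (sampled Y Δ) n w) ^ 2 ∂P) /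
        ((2 : ℝ) ^ p * incrementConst p α * ℓ Δ⁻¹ * Δ ^ (α - 1)))
      (𝓝[>] 0) (𝓝 1) := by
  have hp : 0 < p := by linarith
  have hY2 : ∀ t, MemLp (Y t) 2 P := fun t => (hY.eq_integral t).1
  have hY0 : ∀ t, ∫ w, Y t w ∂P = 0 := fun t => (hY.eq_integral t).integral_eq_zero hL
  refine ⟨fun Δ _ n => fracDiff_memLp_and_tendsto hY2 hY0 hf hp Δ n, fun n => ?_⟩
  have hS : 0 < incrementConst p α := by
    rw [← integral_diffKernel_eq hα hαp]
    exact integral_diffKernel_pos hα hαp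
  have h := (tendsto_integral_one_sub_cos hα hαp hf.integrable hℓ hfℓ).div_const
    (incrementConst p α)
  rw [div_self hS.ne'] at h
  refine h.congr fun Δ => ?_
  rw [integral_fracDiff_sq hY2 hY0 hf hp, div_div, mul_comm _ (incrementConst p α),
    mul_assoc, mul_assoc, mul_div_mul_left _ _ (Real.rpow_pos_of_pos two_pos p).ne']
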